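/- Conventions. Graphs are finite, non-empty and directed, possibly with self-loops. For $d\in\mathbb N$, a $d$-featured graph $G=(V,E,f)$ is a graph $(V,E)$ with an embedding $f\colon V\to\{0,1\}^d$ that is one-hot if $d\ge 1$ (exactly one component of each $f(v)$ is $1$); for $d=0$ it is just a directed graph. An FO classifier is a first-order formula with one free variable over the vocabulary with equality, one binary symbol for edges and $d$ unary symbols for the features. $\mathrm{C}^2$ is the logic over the same vocabulary whose formulas use only two variables (which may be requantified), Boolean connectives and counting quantifiers $\exists_{\ge k}$, $k\in\mathbb N$. A simple ACR-GNN with input dimension $d$ consists of dimensions $d=d_0,\dots,d_L$ with $d_L=1$, real matrices $A_i,C_i,R_i\in\mathbb R^{d_{i-1}\times d_i}$ and vectors $b_i\in\mathbb R^{d_i}$ for $1\le i\le L$, and reals $w,\theta$. On $G$ it computes $f^{(0)}=f$ and $$f^{(i)}(v)=\mathrm{ReLU}\Big(f^{(i-1)}(v)A_i+\sum_{u:(v,u)\in E}f^{(i-1)}(u)\,C_i+\sum_{u\in V}f^{(i-1)}(u)\,R_i+b_i\Big),$$ with $\mathrm{ReLU}(x)=\max(0,x)$ componentwise, and it accepts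 $(G,v)$ if and only if $w\cdot f^{(L)}(v)\ge\theta$. A formula or an ACR-GNN captures a vertex property if, for all $d$-featured graphs $G$ and all vertices $v$ of $G$, it is satisfied by (respectively, accepts) $(G,v)$ exactly when $(G,v)$ has the property; two classifiers are equivalent if they capture the same property. Theorem. For every $d\in\mathbb N$ (in particular, for $d=0$, over plain directed graphs) there is an FO classifier $\varphi(x)$ that captures the property "the edge relation $E$ of $G$ is a strict linear order on $V$" (irreflexive, transitive and total), such that $\varphi$ is not equivalent to any $\mathrm{C}^2$ formula, but is captured by a simple ACR-GNN with input dimension $d$. -/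

import Mathlib

namespace GNNLogic

open FirstOrder

/-! ## Featured graphs -/

/-- A directed `d`-featured graph with vertex set `V`: an arbitrary edge relation (self-loops are
allowed) and a one-hot embedding `V → {0,1}^d`. For `d = 0` the embedding is the empty vector and
carries no information, so that `FeaturedGraph 0 V` is the type of plain directed graphs on `V`. -/
structure FeaturedGraph (d : ℕ) (V : Type) where
  /-- the edge relation -/
  E : V → V → Prop
  /-- the feature vectors -/
  feat : V → Fin d → Bool
  /-- exactly one component of each feature vector is `1` -/
  oneHot : 0 < d → ∀ v, ∃! i, feat v i = true

/-! ## First-order logic over `d`-featured graphs -/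

/-- The relation symbols: `d` unary symbols for the features and one binary symbol for the edges. -/
inductive GraphRel (d : ℕ) : ℕ → Type
  | feat (i : Fin d) : GraphRel d 1
  | edge : GraphRel d 2

/-- The first-order language of `d`-featured graphs (equality is built into Mathlib's formulas). -/
def graphLanguage (d : ℕ) : Language :=
  ⟨fun _ => Empty, GraphRel d⟩

/-- A `d`-featured graph as a first-order structure. -/
@[reducible]
def FeaturedGraph.toStructure {d : ℕ} {V : Type} (G : FeaturedGraph d V) :
    (graphLanguage d).Structure V where
  funMap := fun s _ => Empty.elim s
  RelMap := fun r xs =>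
    match r, xs with
    | GraphRel.feat i, xs => G.feat (xs 0) i = true
    | GraphRel.edge, xs => G.E (xs 0) (xs 1)

/-- FO classifiers: first-order formulas with one free variable. -/
abbrev FOClassifier (d : ℕ) : Type := (graphLanguage d).Formula (Fin 1)

/-- `G, v ⊨ φ` for an FO classifier `φ`. -/
def FOClassifier.Sat {d : ℕ} (φ : FOClassifier d) {V : Type} (G : FeaturedGraph d V) (v : V) :
    Prop :=
  @Language.Formula.Realize (graphLanguage d) V G.toStructure (Fin 1) φ (fun _ => v)

/-! ## Two-variable logic with counting -/

/-- Formulas of the two-variable fragment with counting quantifiers. The two variables are the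
elements of `Fin 2`; they may be reused (requantified) at will. -/
inductive C2Formula (d : ℕ) : Type
  | feat (i : Fin d) (x : Fin 2) : C2Formula d
  | edge (x y : Fin 2) : C2Formula d
  | eq (x y : Fin 2) : C2Formula d
  | not (φ : C2Formula d) : C2Formula d
  | and (φ ψ : C2Formula d) : C2Formula d
  /-- there are at least `k` values of `x` such that `φ` -/
  | existsGE (k : ℕ) (x : Fin 2) (φ : C2Formula d) : C2Formula d

/-- Satisfaction of a two-variable counting formula in a finite graph under an assignment. -/
def C2Formula.Holds {d : ℕ} {V : Type} [Fintype V] (G : FeaturedGraph d V) :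
    C2Formula d → (Fin 2 → V) → Prop
  | .feat i x, s => G.feat (s x) i = true
  | .edge x y, s => G.E (s x) (s y)
  | .eq x y, s => s x = s y
  | .not φ, s => ¬ φ.Holds G s
  | .and φ ψ, s => φ.Holds G s ∧ ψ.Holds G s
  | .existsGE k x φ, s => k ≤ Set.ncard {u : V | φ.Holds G (Function.update s x u)}

/-- `G, v ⊨ φ`: the free variable of `φ` is interpreted by `v`. Both variables are assigned `v`, so
this is the usual notion for formulas in which at most one of the two variables, no matter which,
occurs free (a formula `φ(x, y)` with two free variables is read as `φ(x, x)`). -/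
def C2Formula.Sat {d : ℕ} (φ : C2Formula d) {V : Type} [Fintype V] (G : FeaturedGraph d V)
    (v : V) : Prop :=
  φ.Holds G (fun _ => v)

/-! ## Aggregate-combine-readout GNNs -/

/-- One layer of an ACR-GNN with input dimension `m` and output dimension `n`. -/
structure ACRLayer (m n : ℕ) where
  /-- the combination function; its arguments are the old feature vector of the vertex, the
  aggregated vector and the readout vector, in this order -/
  comb : (Fin m → ℝ) → (Fin m → ℝ) → (Fin m → ℝ) → (Fin n → ℝ)
  /-- the aggregation function -/
  agg : Multiset (Fin m → ℝ) → (Fin m → ℝ)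
  /-- the readout function -/
  read : Multiset (Fin m → ℝ) → (Fin m → ℝ)

open Classical in
/-- The vertex embedding computed by a layer from a given vertex embedding `f`. Aggregation is over
the out-neighbours of a vertex, readout over all vertices. -/
noncomputable def ACRLayer.apply {m n d : ℕ} (ℓ : ACRLayer m n) {V : Type} [Fintype V]
    (G : FeaturedGraph d V) (f : V → Fin m → ℝ) : V → Fin n → ℝ :=
  fun v => ℓ.comb (f v)
    (ℓ.agg ((Finset.univ.filter fun u => G.E v u).val.map f))
    (ℓ.read ((Finset.univ : Finset V).val.map f))

/-- A finite sequence of composable layers from dimension `m` to dimension `n`; the first layer to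
be applied is the head. -/
inductive ACRLayers : ℕ → ℕ → Type
  | nil {n : ℕ} : ACRLayers n n
  | cons {m k n : ℕ} (ℓ : ACRLayer m k) (rest : ACRLayers k n) : ACRLayers m n

/-- The final vertex embedding computed by a sequence of layers. -/
noncomputable def ACRLayers.eval {d : ℕ} {V : Type} [Fintype V] (G : FeaturedGraph d V) :
    {m n : ℕ} → ACRLayers m n → (V → Fin m → ℝ) → (V → Fin n → ℝ)
  | _, _, .nil, f => f
  | _, _, .cons ℓ rest, f => rest.eval G (ℓ.apply G f)

/-- An ACR-GNN with input dimension `d`. -/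
structure ACRGNN (d : ℕ) where
  /-- the dimension after the last layer -/
  outDim : ℕ
  /-- the layers -/
  layers : ACRLayers d outDim
  /-- the binary classifier -/
  cls : (Fin outDim → ℝ) → Bool

/-- The GNN `N` accepts the pointed featured graph `(G, v)`. -/
def ACRGNN.Accepts {d : ℕ} (N : ACRGNN d) {V : Type} [Fintype V] (G : FeaturedGraph d V)
    (v : V) : Prop :=
  N.cls (N.layers.eval G (fun u i => if G.feat u i = true then 1 else 0) v) = true

/-! ## Simple ACR-GNNs -/

open scoped Matrix in
/-- A simple layer: aggregation and readout are sum, and the combination function is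
`ReLU (x₁ A + x₂ C + x₃ R + b)`, with `ReLU` applied componentwise. -/
def ACRLayer.IsSimple {m n : ℕ} (ℓ : ACRLayer m n) : Prop :=
  (∃ (A C R : Matrix (Fin m) (Fin n) ℝ) (b : Fin n → ℝ), ∀ x₁ x₂ x₃ : Fin m → ℝ,
    ℓ.comb x₁ x₂ x₃ = fun j => max 0 ((x₁ ᵥ* A + x₂ ᵥ* C + x₃ ᵥ* R + b) j)) ∧
  (∀ M, ℓ.agg M = M.sum) ∧ (∀ M, ℓ.read M = M.sum)

/-- All layers are simple. -/
def ACRLayers.AllSimple : {m n : ℕ} → ACRLayers m n → Prop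
  | _, _, .nil => True
  | _, _, .cons ℓ rest => ℓ.IsSimple ∧ rest.AllSimple

/-- A simple ACR-GNN: all layers are simple, the last dimension is `1`, and the classifier is a
linear threshold function `x ↦ [w * x ≥ θ]`. -/
def ACRGNN.IsSimple {d : ℕ} (N : ACRGNN d) : Prop :=
  N.layers.AllSimple ∧ N.outDim = 1 ∧
    ∃ w θ : ℝ, ∀ x : Fin N.outDim → ℝ, N.cls x = true ↔ θ ≤ ∑ i, w * x i

/-! ## Strict linear orders -/

/-- The edge relation of `G` is a strict linear order. -/
def FeaturedGraph.IsStrictLinearOrder {d : ℕ} {V : Type} (G : FeaturedGraph d V) : Prop :=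
  (∀ x, ¬ G.E x x) ∧
  (∀ x y, x = y ∨ G.E x y ∨ G.E y x) ∧
  (∀ x y z, G.E x y → G.E y z → G.E x z)

end GNNLogic

/-!
Being a strict linear order is plainly a first-order property.

*The network.* For a relation on `n` vertices with adjacency matrix `M`, `e` edges and `w` walks of
length two, `w` is the sum over the vertices of `in * out`, the product of the indegree and the
outdegree. Since `4 * in * out = (out + in) ^ 2 - (out - in) ^ 2`, a lower bound on `w` follows from
Cauchy-Schwarz for `∑ (out + in) ^ 2`, given `∑ (out + in) = 2 e`, and from an upper bound on
`∑ (out - in) ^ 2`. The latter is a sum over pairs of entries of `M - Mᵀ` in a common row.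
Symmetrized over triples of vertices, it becomes a sum of terms `cornerSum`, each at most `1`, with
equality for all triples other than `(v, v, v)` exactly if the relation off the diagonal is a
transitive tournament. The outcome is `two_mul_walkDefect`: the quantity
`6 w - 6 (n - 1) e + n (n - 1) (2 n - 1)` is nonnegative, and it is zero only for strict linear orders
(`walkDefect_nonpos_iff`). It is linear in `w`, `n * e`, `e` and powers of `n`, all of which are
iterated sums over out-neighbours and over all vertices, and hence a few simple layers compute it.

*The lower bound.* The order on `2 m + 3` elements is compared with the tournament obtained from it
by reversing the single edge between the elements `m` and `m + 2` of its middle, which creates a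
cycle. In the two-variable counting game two vertices far from both ends cannot be distinguished:
each sees many vertices of the middle on either side and the same vertices near the ends. A
quantifier `∃_{≥k}` moves the boundary between end and middle by `k + 1`
(`le_ncard_iff_of_alike`), so a given formula fails to separate the two graphs once `m` is large
(`C2Formula.holds_iff_of_matching`).
-/

namespace GNNLogic

open FirstOrder

/-! ### Strict linear orders by counting walks -/

open Classical in
/-- The adjacency matrix of a relation, with real entries. -/
noncomputable def adj {V : Type} (E : V → V → Prop) (u v : V) : ℝ := if E u v then 1 else 0

/-- For three vertices, the sum over the corners of the products of the two entries of `M - Mᵀ`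
leaving that corner, where `M` is the adjacency matrix. It is `1` on a transitive triangle and `-3`
on a cyclic one. -/
noncomputable def cornerSum {V : Type} (E : V → V → Prop) (u v w : V) : ℝ :=
  (adj E u v - adj E v u) * (adj E u w - adj E w u) +
  (adj E v u - adj E u v) * (adj E v w - adj E w v) +
  (adj E w u - adj E u w) * (adj E w v - adj E v w)

theorem cornerSum_le_one {V : Type} (E : V → V → Prop) (u v w : V) : cornerSum E u v w ≤ 1 := by
  unfold cornerSum adj
  split_ifs <;> norm_num

open Classical in
theorem cornerSum_le {V : Type} (E : V → V → Prop) (u v w : V) :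
    cornerSum E u v w ≤ 1 - if u = v ∧ v = w then 1 else 0 := by
  by_cases h : u = v ∧ v = w
  · obtain ⟨rfl, rfl⟩ := h
    simp [cornerSum]
  · simpa [h] using cornerSum_le_one E u v w

/-- With `n` vertices, `e` edges and `w` walks of length two, the number
`6 w - 6 (n - 1) e + n (n - 1) (2 n - 1)`. For a linear order `e = n (n - 1) / 2` and
`w = n (n - 1) (n - 2) / 6`, and the defect vanishes. -/
noncomputable def walkDefect {V : Type} [Fintype V] (E : V → V → Prop) : ℝ :=
  6 * ∑ v, (∑ u, adj E u v) * (∑ u, adj E v u)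
    - 6 * ((Fintype.card V : ℝ) - 1) * ∑ v, ∑ u, adj E v u
    + 2 * (Fintype.card V : ℝ) ^ 3 - 3 * (Fintype.card V : ℝ) ^ 2 + (Fintype.card V : ℝ)

/-- Each of the three corners contributes the sum over all vertices `v` of
`(outdegree v - indegree v) ^ 2`. -/
theorem sum_cornerSum {V : Type} [Fintype V] (E : V → V → Prop) :
    ∑ u, ∑ v, ∑ w, cornerSum E u v w =
      3 * ∑ v, ((∑ u, adj E v u) - ∑ u, adj E u v) ^ 2 := by
  have key : ∑ v, ((∑ u, adj E v u) - ∑ u, adj E u v) ^ 2 =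
      ∑ u, ∑ v, ∑ w, (adj E u v - adj E v u) * (adj E u w - adj E w u) := by
    refine Finset.sum_congr rfl fun u _ => ?_
    rw [← Finset.sum_sub_distrib, sq, Finset.sum_mul_sum]
  have h2 : ∑ u, ∑ v, ∑ w, (adj E v u - adj E u v) * (adj E v w - adj E w v) =
      ∑ v, ∑ u, ∑ w, (adj E v u - adj E u v) * (adj E v w - adj E w v) := Finset.sum_comm
  have h3 : ∑ u, ∑ v, ∑ w, (adj E w u - adj E u w) * (adj E w v - adj E v w) =
      ∑ w, ∑ u, ∑ v, (adj E w u - adj E u w) * (adj E w v - adj E v w) :=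
    (Finset.sum_congr rfl fun u _ => Finset.sum_comm).trans Finset.sum_comm
  simp only [cornerSum, Finset.sum_add_distrib]
  rw [h2, h3, key]
  ring

open Classical in
/-- Twice the defect is a sum of nonnegative terms. It comes from
`4 ∑ in * out = ∑ (out + in) ^ 2 - ∑ (out - in) ^ 2`, where the first sum is expanded around the mean
`n - 1` and the second one is `∑ cornerSum / 3`. -/
theorem two_mul_walkDefect {V : Type} [Fintype V] (E : V → V → Prop) :
    2 * walkDefect E =
      3 * ∑ v, ((∑ u, adj E v u) + (∑ u, adj E u v) - ((Fintype.card V : ℝ) - 1)) ^ 2 +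
      ∑ u, ∑ v, ∑ w, ((1 - if u = v ∧ v = w then 1 else 0) - cornerSum E u v w) := by
  have hcard : ∑ u : V, ∑ v : V, ∑ w : V, ((1 : ℝ) - if u = v ∧ v = w then 1 else 0) =
      (Fintype.card V : ℝ) ^ 3 - Fintype.card V := by
    simp [Finset.sum_sub_distrib, ite_and]
    ring
  have hin : ∑ v, ∑ u, adj E u v = ∑ v, ∑ u, adj E v u := Finset.sum_comm
  have hT : ∑ u, ∑ v, ∑ w, ((1 - if u = v ∧ v = w then 1 else 0) - cornerSum E u v w) =
      (Fintype.card V : ℝ) ^ 3 - Fintype.card V -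
        3 * ∑ v, ((∑ u, adj E v u) - ∑ u, adj E u v) ^ 2 := by
    rw [← hcard, ← sum_cornerSum]
    simp only [Finset.sum_sub_distrib]
  have hS : ∑ v, ((∑ u, adj E v u) + (∑ u, adj E u v) - ((Fintype.card V : ℝ) - 1)) ^ 2 =
      ∑ v, ((∑ u, adj E v u) - ∑ u, adj E u v) ^ 2
        + 4 * ∑ v, (∑ u, adj E u v) * (∑ u, adj E v u)
        - 2 * ((Fintype.card V : ℝ) - 1) * (∑ v, ∑ u, adj E v u)
        - 2 * ((Fintype.card V : ℝ) - 1) * (∑ v, ∑ u, adj E u v)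
        + Fintype.card V * ((Fintype.card V : ℝ) - 1) ^ 2 := by
    have hc : (Fintype.card V : ℝ) * ((Fintype.card V : ℝ) - 1) ^ 2 =
      ∑ _v : V, ((Fintype.card V : ℝ) - 1) ^ 2 := by simp
    rw [hc, Finset.mul_sum, Finset.mul_sum, Finset.mul_sum, ← Finset.sum_add_distrib,
      ← Finset.sum_sub_distrib, ← Finset.sum_sub_distrib, ← Finset.sum_add_distrib]
    exact Finset.sum_congr rfl fun v _ => by ring
  rw [hT, hS, hin, walkDefect]
  ring

theorem walkDefect_nonneg {V : Type} [Fintype V] (E : V → V → Prop) : 0 ≤ walkDefect E := by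
  classical
  have h := two_mul_walkDefect E
  have h1 : 0 ≤ ∑ v, ((∑ u, adj E v u) + (∑ u, adj E u v) - ((Fintype.card V : ℝ) - 1)) ^ 2 :=
    Finset.sum_nonneg fun _ _ => sq_nonneg _
  have h2 : 0 ≤ ∑ u, ∑ v, ∑ w,
      ((1 - if u = v ∧ v = w then 1 else 0) - cornerSum E u v w) :=
    Finset.sum_nonneg fun u _ => Finset.sum_nonneg fun v _ => Finset.sum_nonneg fun w _ =>
      sub_nonneg.2 (cornerSum_le E u v w)
  linarith

/-- If all triangles are transitive and every total degree is `n - 1`, the relation is a strict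
linear order. -/
theorem isStrictLinearOrder_of_cornerSum {V : Type} [Fintype V] {E : V → V → Prop}
    (hdeg : ∀ v, (∑ u, adj E v u) + (∑ u, adj E u v) = (Fintype.card V : ℝ) - 1)
    (hT : ∀ u v w, ¬ (u = v ∧ v = w) → cornerSum E u v w = 1) :
    (∀ x, ¬ E x x) ∧ (∀ x y, x = y ∨ E x y ∨ E y x) ∧ (∀ x y z, E x y → E y z → E x z) := by
  classical
  have htour : ∀ x y, x ≠ y → (E x y ∧ ¬ E y x) ∨ (E y x ∧ ¬ E x y) := by
    intro x y hxy
    -- On a degenerate triple `cornerSum` is the square of the entry of `M - Mᵀ` at `(x, y)`.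
    have := hT x x y (by simp [hxy])
    unfold cornerSum adj at this
    by_cases h1 : E x y <;> by_cases h2 : E y x <;> simp [h1, h2] at this ⊢
  have hirr : ∀ x, ¬ E x x := by
    intro x hx
    -- A loop at `x` adds two to the total degree `n - 1` that `x` has in a tournament.
    have h := hdeg x
    have hsum : ∑ u, (adj E x u + adj E u x) = ∑ u, (1 + if u = x then (1 : ℝ) else 0) := by
      refine Finset.sum_congr rfl fun u _ => ?_
      by_cases hu : u = x
      · subst hu; simp [adj, hx]
      · rcases htour u x hu with ⟨h1, h2⟩ | ⟨h1, h2⟩ <;> simp [adj, h1, h2, hu]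
    rw [← Finset.sum_add_distrib, hsum, Finset.sum_add_distrib] at h
    simp at h
    linarith
  refine ⟨hirr, fun x y => ?_, fun x y z hxy hyz => ?_⟩
  · by_cases hxy : x = y
    · exact Or.inl hxy
    · rcases htour x y hxy with h | h
      · exact Or.inr (Or.inl h.1)
      · exact Or.inr (Or.inr h.1)
  · have nxy : x ≠ y := by rintro rfl; exact hirr _ hxy
    have nyz : y ≠ z := by rintro rfl; exact hirr _ hyz
    have hyx : ¬ E y x := fun h => by rcases htour x y nxy with h' | h' <;> tauto
    have hzy : ¬ E z y := fun h => by rcases htour y z nyz with h' | h' <;> tauto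
    have := hT x y z (by simp [nxy])
    unfold cornerSum adj at this
    by_contra hxz
    by_cases hzx : E z x <;> simp [hxy, hyz, hyx, hzy, hxz, hzx] at this <;> norm_num at this

/-- In a strict linear order the defect vanishes. -/
theorem walkDefect_eq_zero_of_isStrictLinearOrder {V : Type} [Fintype V] {E : V → V → Prop}
    (hirr : ∀ x, ¬ E x x) (htot : ∀ x y, x = y ∨ E x y ∨ E y x)
    (htr : ∀ x y z, E x y → E y z → E x z) : walkDefect E = 0 := by
  classical
  have hasymm : ∀ x y, E x y → ¬ E y x := fun x y h h' => hirr x (htr _ _ _ h h')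
  have hpair : ∀ x y, x ≠ y → (E x y ∧ ¬ E y x) ∨ (E y x ∧ ¬ E x y) := fun x y h => by
    rcases htot x y with h' | h' | h'
    · exact absurd h' h
    · exact Or.inl ⟨h', hasymm _ _ h'⟩
    · exact Or.inr ⟨h', hasymm _ _ h'⟩
  have h1 : ∑ v, ((∑ u, adj E v u) + (∑ u, adj E u v) - ((Fintype.card V : ℝ) - 1)) ^ 2 = 0 := by
    refine Finset.sum_eq_zero fun v _ => ?_
    have hsum : ∑ u, (adj E v u + adj E u v) = ∑ u, (1 - if u = v then (1 : ℝ) else 0) := by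
      refine Finset.sum_congr rfl fun u _ => ?_
      by_cases hu : u = v
      · subst hu; simp [adj, hirr]
      · rcases hpair u v hu with ⟨h1, h2⟩ | ⟨h1, h2⟩ <;> simp [adj, h1, h2, hu]
    rw [← Finset.sum_add_distrib, hsum, Finset.sum_sub_distrib]
    simp
  have h2 : ∑ u, ∑ v, ∑ w,
      ((1 - if u = v ∧ v = w then 1 else 0) - cornerSum E u v w) = 0 := by
    refine Finset.sum_eq_zero fun u _ => Finset.sum_eq_zero fun v _ =>
      Finset.sum_eq_zero fun w _ => ?_
    by_cases huv : u = v
    · subst huv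
      by_cases huw : u = w
      · subst huw; simp [cornerSum]
      · rcases hpair u w huw with ⟨h1, h2⟩ | ⟨h1, h2⟩ <;> simp [cornerSum, adj, h1, h2, huw]
    · by_cases huw : u = w
      · subst huw
        rcases hpair u v huv with ⟨h1, h2⟩ | ⟨h1, h2⟩ <;> simp [cornerSum, adj, h1, h2, huv]
      · by_cases hvw : v = w
        · subst hvw
          rcases hpair u v huv with ⟨h1, h2⟩ | ⟨h1, h2⟩ <;> simp [cornerSum, adj, h1, h2, huv]
        · have ht1 := htr u v w
          have ht2 := htr w v u
          rcases hpair u v huv with ⟨h1, h2⟩ | ⟨h1, h2⟩ <;>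
          rcases hpair u w huw with ⟨h3, h4⟩ | ⟨h3, h4⟩ <;>
          rcases hpair v w hvw with ⟨h5, h6⟩ | ⟨h5, h6⟩ <;>
          simp_all [cornerSum, adj]
  have h := two_mul_walkDefect E
  rw [h1, h2] at h
  linarith

/-- The numerical characterization of strict linear orders evaluated by the network. -/
theorem walkDefect_nonpos_iff {d : ℕ} {V : Type} [Fintype V] (G : FeaturedGraph d V) :
    walkDefect G.E ≤ 0 ↔ G.IsStrictLinearOrder := by
  classical
  constructor
  · intro hle
    have h := two_mul_walkDefect G.E
    have h1 : 0 ≤ ∑ v, ((∑ u, adj G.E v u) + (∑ u, adj G.E u v)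
        - ((Fintype.card V : ℝ) - 1)) ^ 2 := Finset.sum_nonneg fun _ _ => sq_nonneg _
    have hnn : ∀ u v w, 0 ≤ (1 - if u = v ∧ v = w then 1 else 0) - cornerSum G.E u v w :=
      fun u v w => sub_nonneg.2 (cornerSum_le G.E u v w)
    have hnn' : ∀ u v, 0 ≤ ∑ w, ((1 - if u = v ∧ v = w then 1 else 0) - cornerSum G.E u v w) :=
      fun u v => Finset.sum_nonneg fun w _ => hnn u v w
    have hnn'' : ∀ u, 0 ≤ ∑ v, ∑ w,
        ((1 - if u = v ∧ v = w then 1 else 0) - cornerSum G.E u v w) :=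
      fun u => Finset.sum_nonneg fun v _ => hnn' u v
    have h2 := Finset.sum_nonneg fun u (_ : u ∈ Finset.univ) => hnn'' u
    have e1 : ∑ v, ((∑ u, adj G.E v u) + (∑ u, adj G.E u v)
        - ((Fintype.card V : ℝ) - 1)) ^ 2 = 0 := by linarith
    have e2 : ∑ u, ∑ v, ∑ w,
        ((1 - if u = v ∧ v = w then 1 else 0) - cornerSum G.E u v w) = 0 := by linarith
    rw [Finset.sum_eq_zero_iff_of_nonneg fun _ _ => sq_nonneg _] at e1
    refine isStrictLinearOrder_of_cornerSum (fun v => ?_) fun u v w hne => ?_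
    · have := e1 v (Finset.mem_univ v)
      have := pow_eq_zero_iff (two_ne_zero) |>.1 this
      linarith
    · rw [Finset.sum_eq_zero_iff_of_nonneg fun u _ => hnn'' u] at e2
      have e3 := e2 u (Finset.mem_univ u)
      rw [Finset.sum_eq_zero_iff_of_nonneg fun v _ => hnn' u v] at e3
      have e4 := e3 v (Finset.mem_univ v)
      rw [Finset.sum_eq_zero_iff_of_nonneg fun w _ => hnn u v w] at e4
      have e5 := e4 w (Finset.mem_univ w)
      rw [if_neg hne] at e5
      linarith
  · rintro ⟨h1, h2, h3⟩
    exact (walkDefect_eq_zero_of_isStrictLinearOrder h1 h2 h3).le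

/-! ### The first-order formula -/

open FirstOrder Language in
/-- The edge atom between two bound variables. -/
def edgeAtom {d n : ℕ} (i j : Fin n) : (graphLanguage d).BoundedFormula (Fin 1) n :=
  Relations.boundedFormula₂ (L := graphLanguage d) (GraphRel.edge : GraphRel d 2)
    (Term.var (Sum.inr i)) (Term.var (Sum.inr j))

theorem realize_edgeAtom {d n : ℕ} {V : Type} (G : FeaturedGraph d V) (i j : Fin n)
    (v : Fin 1 → V) (xs : Fin n → V) :
    @Language.BoundedFormula.Realize (graphLanguage d) V G.toStructure _ _ (edgeAtom i j) v xs ↔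
      G.E (xs i) (xs j) := by
  let := G.toStructure
  exact Language.BoundedFormula.realize_rel₂

open FirstOrder Language in
/-- The first-order axioms of strict linear orders. The free variable does not occur. -/
def linearOrderFormula (d : ℕ) : FOClassifier d :=
  ((edgeAtom (0 : Fin 1) 0).not.all ⊓
    ((Term.bdEqual (Term.var (Sum.inr 0)) (Term.var (Sum.inr 1))) ⊔
      ((edgeAtom (0 : Fin 2) 1) ⊔ (edgeAtom (1 : Fin 2) 0))).all.all ⊓
    ((edgeAtom (0 : Fin 3) 1).imp ((edgeAtom 1 2).imp (edgeAtom 0 2))).all.all.all :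
    (graphLanguage d).BoundedFormula (Fin 1) 0)

theorem sat_linearOrderFormula {d : ℕ} {V : Type} (G : FeaturedGraph d V) (v : V) :
    (linearOrderFormula d).Sat G v ↔ G.IsStrictLinearOrder := by
  let := G.toStructure
  simp only [FOClassifier.Sat, linearOrderFormula, Language.Formula.Realize,
    Language.BoundedFormula.realize_inf, Language.BoundedFormula.realize_sup,
    Language.BoundedFormula.realize_all, Language.BoundedFormula.realize_not,
    Language.BoundedFormula.realize_imp, Language.BoundedFormula.realize_bdEqual,
    realize_edgeAtom, FeaturedGraph.IsStrictLinearOrder, and_assoc]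
  rfl

/-! ### The network -/

open scoped Matrix in
/-- The simple layer with the given parameters. -/
noncomputable def simpleLayer {m n : ℕ} (A C R : Matrix (Fin m) (Fin n) ℝ) (b : Fin n → ℝ) :
    ACRLayer m n where
  comb x₁ x₂ x₃ := fun j => max 0 ((x₁ ᵥ* A + x₂ ᵥ* C + x₃ ᵥ* R + b) j)
  agg M := M.sum
  read M := M.sum

theorem simpleLayer_isSimple {m n : ℕ} (A C R : Matrix (Fin m) (Fin n) ℝ) (b : Fin n → ℝ) :
    (simpleLayer A C R b).IsSimple :=
  ⟨⟨A, C, R, b, fun _ _ _ => rfl⟩, fun _ => rfl, fun _ => rfl⟩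

theorem simpleLayer_apply {m n d : ℕ} (A C R : Matrix (Fin m) (Fin n) ℝ) (b : Fin n → ℝ)
    {V : Type} [Fintype V] (G : FeaturedGraph d V) (f : V → Fin m → ℝ) (v : V) (j : Fin n) :
    (simpleLayer A C R b).apply G f v j =
      max 0 (∑ i, f v i * A i j + ∑ i, (∑ u, adj G.E v u * f u i) * C i j
        + ∑ i, (∑ u, f u i) * R i j + b j) := by
  classical
  have hagg : ∀ i, ((Finset.univ.filter fun u => G.E v u).val.map f).sum i =
      ∑ u, adj G.E v u * f u i := fun i => by
    change (∑ u ∈ Finset.univ.filter (fun u => G.E v u), f u) i = _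
    rw [Finset.sum_apply, Finset.sum_filter]
    exact Finset.sum_congr rfl fun u _ => by by_cases h : G.E v u <;> simp [adj, h]
  have hread : ∀ i, ((Finset.univ : Finset V).val.map f).sum i = ∑ u, f u i := fun i =>
    Finset.sum_apply i _ _
  simp only [← hagg, ← hread]
  rfl

/-- Computes the number `n` of vertices and the outdegree from the constant embedding `1`. -/
noncomputable def degreeLayer : ACRLayer 1 2 :=
  simpleLayer 0 !![0, 1] !![1, 0] 0

/-- Computes `n`, `n ^ 2`, the number of edges, and the number of walks of length two
from the vertex. -/
noncomputable def walkLayer : ACRLayer 2 4 :=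
  simpleLayer !![1, 0, 0, 0; 0, 0, 0, 0] !![0, 0, 0, 0; 0, 0, 0, 1]
    !![0, 1, 0, 0; 0, 0, 1, 0] 0

/-- Computes the walk defect. The quantities `n ^ 3` and `n` times the number of edges are
readouts of `n ^ 2` and of the number of edges, which are the same at all vertices. -/
noncomputable def defectLayer : ACRLayer 4 1 :=
  simpleLayer !![1; -3; 6; 0] 0 !![0; 2; -6; 6] 0

/-- The network computing the walk defect and testing whether it is at most `0`. Its first layer
forgets the features and outputs the constant `1`, so that it also serves for `d = 0`. -/
noncomputable def linearOrderGNN (d : ℕ) : ACRGNN d where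
  outDim := 1
  layers := .cons (simpleLayer 0 0 0 1) (.cons degreeLayer (.cons walkLayer
    (.cons defectLayer .nil)))
  cls x := decide (x 0 ≤ 0)

theorem linearOrderGNN_isSimple (d : ℕ) : (linearOrderGNN d).IsSimple := by
  refine ⟨⟨simpleLayer_isSimple _ _ _ _, simpleLayer_isSimple _ _ _ _,
    simpleLayer_isSimple _ _ _ _, simpleLayer_isSimple _ _ _ _, trivial⟩, rfl, -1, 0, ?_⟩
  intro (x : Fin 1 → ℝ)
  change decide (x 0 ≤ 0) = true ↔ 0 ≤ ∑ i : Fin 1, -1 * x i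
  simp

theorem linearOrderGNN_accepts {d : ℕ} {V : Type} [Fintype V] (G : FeaturedGraph d V) (v : V) :
    (linearOrderGNN d).Accepts G v ↔ G.IsStrictLinearOrder := by
  rw [← walkDefect_nonpos_iff]
  have hadj : ∀ u w, 0 ≤ adj G.E u w := fun u w => by unfold adj; split_ifs <;> norm_num
  have hdeg : ∀ u, 0 ≤ ∑ w, adj G.E u w := fun u => Finset.sum_nonneg fun w _ => hadj u w
  have hwalk : ∀ u, 0 ≤ ∑ w, adj G.E u w * ∑ z, adj G.E w z := fun u =>
    Finset.sum_nonneg fun w _ => mul_nonneg (hadj u w) (hdeg w)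
  -- All the values computed are nonnegative, so that `ReLU` never has an effect.
  have h1 : ∀ f, (simpleLayer (m := d) (n := 1) 0 0 0 1).apply G f = fun _ => ![1] := fun f => by
    ext u j
    fin_cases j
    rw [simpleLayer_apply]
    simp
  have h2 : degreeLayer.apply G (fun _ => ![1]) =
      fun u => ![(Fintype.card V : ℝ), ∑ w, adj G.E u w] := by
    ext u j
    rw [degreeLayer, simpleLayer_apply]
    fin_cases j
    · simp
    · simpa using hdeg u
  have h3 : walkLayer.apply G (fun u => ![(Fintype.card V : ℝ), ∑ w, adj G.E u w]) =
      fun u => ![(Fintype.card V : ℝ), (Fintype.card V : ℝ) ^ 2, ∑ u, ∑ w, adj G.E u w,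
        ∑ w, adj G.E u w * ∑ z, adj G.E w z] := by
    ext u j
    rw [walkLayer, simpleLayer_apply]
    fin_cases j
    · simp
    · simpa [sq] using mul_self_nonneg (Fintype.card V : ℝ)
    · simpa using Finset.sum_nonneg fun u _ => hdeg u
    · simpa using hwalk u
  have hw : ∑ u, ∑ w, adj G.E u w * ∑ z, adj G.E w z =
      ∑ v, (∑ u, adj G.E u v) * (∑ u, adj G.E v u) := by
    rw [Finset.sum_comm]
    simp only [Finset.sum_mul]
  have h4 : defectLayer.apply G (fun u => ![(Fintype.card V : ℝ), (Fintype.card V : ℝ) ^ 2,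
      ∑ u, ∑ w, adj G.E u w, ∑ w, adj G.E u w * ∑ z, adj G.E w z]) v 0 = walkDefect G.E := by
    rw [defectLayer, simpleLayer_apply]
    refine Eq.trans ?_ (max_eq_right (walkDefect_nonneg G.E))
    congr 1
    simp [Fin.sum_univ_succ, walkDefect, hw]
    ring
  change decide ((linearOrderGNN d).layers.eval G _ v (0 : Fin 1) ≤ 0) = true ↔ _
  rw [decide_eq_true_iff]
  simp only [linearOrderGNN, ACRLayers.eval]
  rw [h1, h2, h3, h4]

/-! ### Two-variable counting logic -/

/-- The usual order of natural numbers with the single pair `(m, m + 2)` reversed. -/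
def flipLT (m i j : ℕ) : Prop := (i < j ∧ ¬ (i = m ∧ j = m + 2)) ∨ (i = m + 2 ∧ j = m)

/-- The graph on `Fin N` with the given edges in which all vertices have the first feature. -/
def uniformGraph (d N : ℕ) (E : ℕ → ℕ → Prop) : FeaturedGraph d (Fin N) where
  E i j := E i j
  feat _ i := decide (i.val = 0)
  oneHot hd _ := ⟨⟨0, hd⟩, by simp, fun i hi => Fin.ext (by simpa using hi)⟩

/-- Two vertices of `Fin N` are alike at distance `t` if they are equal or both at distance at least
`t` from either end. -/
def Alike {N : ℕ} (t : ℕ) (i j : Fin N) : Prop :=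
  i = j ∨ ((t ≤ i.val ∧ i.val + t < N) ∧ (t ≤ j.val ∧ j.val + t < N))

/-- The winning positions of the duplicator in the two-variable counting game: the pebbled vertices
are pairwise alike at distance `t`, and they satisfy the same equalities and edges. -/
structure Matching {N : ℕ} (m t : ℕ) (s s' : Fin 2 → Fin N) : Prop where
  alike : ∀ x, Alike t (s x) (s' x)
  eq_iff : ∀ x y, s x = s y ↔ s' x = s' y
  edge_iff : ∀ x y, (s x).val < (s y).val ↔ flipLT m (s' x) (s' y)

/-- How far from the ends two vertices must be for a formula not to separate them: every quantifier
`∃_{≥k}` costs `k + 1`. -/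
def C2Formula.radius {d : ℕ} : C2Formula d → ℕ
  | .feat _ _ => 0
  | .edge _ _ => 0
  | .eq _ _ => 0
  | .not φ => φ.radius
  | .and φ ψ => max φ.radius ψ.radius
  | .existsGE k _ φ => k + 1 + φ.radius

theorem le_ncard_of_Ico {N a k : ℕ} (h : a + k ≤ N) {S : Set (Fin N)}
    (hS : ∀ u : Fin N, a ≤ u.val → u.val < a + k → u ∈ S) : k ≤ S.ncard := by
  let f : Fin k → Fin N := fun i => ⟨a + i, by omega⟩
  have hf : Function.Injective f := fun i j hij => by
    have := congrArg Fin.val hij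
    simp only [f] at this
    exact Fin.ext (by omega)
  have hsub : Set.range f ⊆ S := by
    rintro _ ⟨i, rfl⟩
    exact hS _ (by simp [f]) (by simp [f])
  calc k = (Set.range f).ncard := by
        rw [← Set.image_univ, Set.ncard_image_of_injective _ hf, Set.ncard_univ, Nat.card_fin]
    _ ≤ S.ncard := Set.ncard_le_ncard hsub (Set.toFinite _)

/-- The quantifier step of the counting game. -/
theorem le_ncard_iff_of_alike {m t t' k : ℕ} (ht : k + 1 + t' ≤ t) (htm : t ≤ m)
    {a b : Fin (2 * m + 3)} (hab : Alike t a b) {P P' : Fin (2 * m + 3) → Prop}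
    (hP : ∀ u u', Alike t' u u' → (u = a ↔ u' = b) →
      (u.val < a.val ↔ flipLT m u' b) → (a.val < u.val ↔ flipLT m b u') → (P u ↔ P' u')) :
    k ≤ Set.ncard {u | P u} ↔ k ≤ Set.ncard {u | P' u} := by
  by_cases hin : (t ≤ a.val ∧ a.val + t < 2 * m + 3) ∧ (t ≤ b.val ∧ b.val + t < 2 * m + 3)
  swap
  · -- Close to an end the two vertices coincide, and the reversed pair does not involve them.
    obtain rfl : a = b := hab.resolve_right hin
    have : ∀ u, P u ↔ P' u := fun u => hP u u (Or.inl rfl) Iff.rfl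
      (by unfold flipLT; omega) (by unfold flipLT; omega)
    simp only [this]
  rcases Nat.eq_zero_or_pos k with rfl | hk
  · simp
  -- There is room for `k` vertices between distance `t'` and distance `t` from either end.
  have hlow : ∀ w : Fin (2 * m + 3), t' ≤ w.val → w.val < t' + k → ∀ u,
      (t' ≤ u.val ∧ u.val + t' < 2 * m + 3) →
      (u.val < a.val → (P u ↔ P' w)) ∧ (flipLT m u b → (P w ↔ P' u)) := by
    intro w hw1 hw2 u hu
    refine ⟨fun h => hP u w (Or.inr ⟨hu, by omega⟩) ?_ ?_ ?_,
      fun h => hP w u (Or.inr ⟨by omega, hu⟩) ?_ ?_ ?_⟩ <;>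
      simp only [flipLT, Fin.ext_iff] at * <;> omega
  have hhigh : ∀ w : Fin (2 * m + 3), 2 * m + 3 - t' - k ≤ w.val →
      w.val < 2 * m + 3 - t' - k + k → ∀ u,
      (t' ≤ u.val ∧ u.val + t' < 2 * m + 3) →
      (a.val < u.val → (P u ↔ P' w)) ∧ (flipLT m b u → (P w ↔ P' u)) := by
    intro w hw1 hw2 u hu
    refine ⟨fun h => hP u w (Or.inr ⟨hu, by omega⟩) ?_ ?_ ?_,
      fun h => hP w u (Or.inr ⟨by omega, hu⟩) ?_ ?_ ?_⟩ <;>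
      simp only [flipLT, Fin.ext_iff] at * <;> omega
  have hlow' : ∀ w : Fin (2 * m + 3), t' ≤ w.val → w.val < t' + k → (P w ↔ P' w) :=
    fun w h1 h2 => (hlow w h1 h2 w (by omega)).1 (by omega)
  have hhigh' : ∀ w : Fin (2 * m + 3), 2 * m + 3 - t' - k ≤ w.val →
      w.val < 2 * m + 3 - t' - k + k → (P w ↔ P' w) :=
    fun w h1 h2 => (hhigh w h1 h2 w (by omega)).1 (by omega)
  by_cases hex : ∃ u : Fin (2 * m + 3), (t' ≤ u.val ∧ u.val + t' < 2 * m + 3) ∧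
      ((u ≠ a ∧ P u) ∨ (u ≠ b ∧ P' u))
  · -- One witness far from the ends yields `k` witnesses in both graphs.
    obtain ⟨u, hu, h⟩ := hex
    have hcases : (∀ w : Fin (2 * m + 3), t' ≤ w.val → w.val < t' + k → P w ∧ P' w) ∨
        (∀ w : Fin (2 * m + 3), 2 * m + 3 - t' - k ≤ w.val →
          w.val < 2 * m + 3 - t' - k + k → P w ∧ P' w) := by
      rcases h with ⟨hne, hPu⟩ | ⟨hne, hPu⟩
      · rcases lt_or_gt_of_ne (Fin.val_ne_of_ne hne) with hlt | hlt
        · refine Or.inl fun w h1 h2 => ?_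
          have := ((hlow w h1 h2 u hu).1 hlt).1 hPu
          exact ⟨(hlow' w h1 h2).2 this, this⟩
        · refine Or.inr fun w h1 h2 => ?_
          have := ((hhigh w h1 h2 u hu).1 hlt).1 hPu
          exact ⟨(hhigh' w h1 h2).2 this, this⟩
      · have hne' := Fin.val_ne_of_ne hne
        have hdir : flipLT m u b ∨ flipLT m b u := by unfold flipLT; omega
        rcases hdir with hlt | hlt
        · refine Or.inl fun w h1 h2 => ?_
          have := ((hlow w h1 h2 u hu).2 hlt).2 hPu
          exact ⟨this, (hlow' w h1 h2).1 this⟩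
        · refine Or.inr fun w h1 h2 => ?_
          have := ((hhigh w h1 h2 u hu).2 hlt).2 hPu
          exact ⟨this, (hhigh' w h1 h2).1 this⟩
    rcases hcases with h | h
    · exact iff_of_true (le_ncard_of_Ico (by omega) fun u h1 h2 => (h u h1 h2).1)
        (le_ncard_of_Ico (by omega) fun u h1 h2 => (h u h1 h2).2)
    · exact iff_of_true (le_ncard_of_Ico (by omega) fun u h1 h2 => (h u h1 h2).1)
        (le_ncard_of_Ico (by omega) fun u h1 h2 => (h u h1 h2).2)
  · -- Otherwise exchanging `a` and `b` carries one set of witnesses to the other.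
    push Not at hex
    have hswap : ∀ u, P u ↔ P' (Equiv.swap a b u) := by
      intro u
      by_cases hua : u = a
      · subst hua
        rw [Equiv.swap_apply_left]
        exact hP u b (Or.inr (by omega)) (by simp) (by unfold flipLT; omega)
          (by unfold flipLT; omega)
      by_cases hub : u = b
      · subst hub
        rw [Equiv.swap_apply_right]
        exact iff_of_false ((hex u (by omega)).1 hua) ((hex a (by omega)).2 (Ne.symm hua))
      rw [Equiv.swap_apply_of_ne_of_ne hua hub]
      by_cases hu : t' ≤ u.val ∧ u.val + t' < 2 * m + 3
      · exact iff_of_false ((hex u hu).1 hua) ((hex u hu).2 hub)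
      · exact hP u u (Or.inl rfl) (iff_of_false hua hub)
          (by unfold flipLT; omega) (by unfold flipLT; omega)
    have himg : {u | P' u} = Equiv.swap a b '' {u | P u} := by
      rw [Equiv.image_eq_preimage_symm]
      ext u
      simp [hswap]
    rw [himg, Set.ncard_image_of_injective _ (Equiv.injective _)]

theorem Matching.mono {N m t t' : ℕ} {s s' : Fin 2 → Fin N} (h : Matching m t s s')
    (ht : t' ≤ t) : Matching m t' s s' :=
  ⟨fun x => (h.alike x).imp_right (by omega), h.eq_iff, h.edge_iff⟩

theorem Matching.update {N m t : ℕ} {s s' : Fin 2 → Fin N} (h : Matching m t s s')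
    {x y : Fin 2} (hxy : x ≠ y) {u u' : Fin N} (hu : Alike t u u') (heq : u = s y ↔ u' = s' y)
    (hlt : u.val < (s y).val ↔ flipLT m u' (s' y))
    (hgt : (s y).val < u.val ↔ flipLT m (s' y) u') :
    Matching m t (Function.update s x u) (Function.update s' x u') := by
  have hz : ∀ z, z = x ∨ z = y := by omega
  have hirr : ∀ i, ¬ flipLT m i i := by unfold flipLT; omega
  refine ⟨fun z => ?_, fun z w => ?_, fun z w => ?_⟩
  · rcases hz z with rfl | rfl
    · simpa using hu
    · simpa [hxy.symm] using h.alike z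
  · rcases hz z with rfl | rfl <;> rcases hz w with rfl | rfl <;>
      simp [hxy.symm, heq, eq_comm (b := u), eq_comm (b := u')]
  · rcases hz z with rfl | rfl <;> rcases hz w with rfl | rfl <;>
      simp_all [hxy.symm]

theorem C2Formula.holds_iff_of_matching {d m : ℕ} (φ : C2Formula d) :
    ∀ {t : ℕ} {s s' : Fin 2 → Fin (2 * m + 3)}, φ.radius ≤ t → t ≤ m → Matching m t s s' →
      (φ.Holds (uniformGraph d _ (· < ·)) s ↔ φ.Holds (uniformGraph d _ (flipLT m)) s') := by
  induction φ with
  | feat i x => intros; rfl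
  | edge x y => intro t s s' _ _ h; exact h.edge_iff x y
  | eq x y => intro t s s' _ _ h; exact h.eq_iff x y
  | not φ ih => intro t s s' ht htm h; exact not_congr (ih ht htm h)
  | and φ ψ ih₁ ih₂ =>
    intro t s s' ht htm h
    exact and_congr (ih₁ ((le_max_left _ _).trans ht) htm h)
      (ih₂ ((le_max_right _ _).trans ht) htm h)
  | existsGE k x φ ih =>
    intro t s s' ht htm h
    simp only [C2Formula.radius] at ht
    obtain ⟨y, hxy⟩ : ∃ y : Fin 2, x ≠ y := ⟨x + 1, by omega⟩
    exact le_ncard_iff_of_alike ht htm (h.alike y) fun u u' hu heq hlt hgt =>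
      ih le_rfl (by omega) ((h.mono (by omega)).update hxy hu heq hlt hgt)

/-- No two-variable counting formula defines the strict linear orders. -/
theorem not_exists_C2Formula_isStrictLinearOrder (d : ℕ) :
    ¬ ∃ ψ : C2Formula d, ∀ (V : Type) [Fintype V] (G : FeaturedGraph d V) (v : V),
      ψ.Sat G v ↔ G.IsStrictLinearOrder := by
  rintro ⟨ψ, hψ⟩
  obtain ⟨m, hm⟩ : ∃ m, m = ψ.radius := ⟨_, rfl⟩
  have hmatch : Matching m m (fun _ => (0 : Fin (2 * m + 3))) (fun _ => 0) :=
    ⟨fun _ => Or.inl rfl, fun _ _ => Iff.rfl, fun _ _ => by unfold flipLT; simp⟩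
  have hiff := ψ.holds_iff_of_matching hm.ge le_rfl hmatch
  have hlin : (uniformGraph d (2 * m + 3) (· < ·)).IsStrictLinearOrder :=
    ⟨fun x => lt_irrefl x, fun x y => or_left_comm.1 (lt_trichotomy x y),
      fun x y z => lt_trans (a := x) (b := y) (c := z)⟩
  have hflip := (hψ _ _ _).1 (hiff.1 ((hψ _ _ _).2 hlin))
  have := hflip.2.2 ⟨m, by omega⟩ ⟨m + 1, by omega⟩ ⟨m + 2, by omega⟩
  simp [uniformGraph, flipLT] at this

end GNNLogic

theorem mainTheorem1 (d : ℕ) :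
    ∃ φ : GNNLogic.FOClassifier d,
      -- the vertex property defined by `φ` is "the edge relation is a strict linear order"
      (∀ (V : Type) [Fintype V] (G : GNNLogic.FeaturedGraph d V) (v : V),
        φ.Sat G v ↔ G.IsStrictLinearOrder) ∧
      -- `φ` is not equivalent to any two-variable counting formula
      (¬ ∃ ψ : GNNLogic.C2Formula d,
        ∀ (V : Type) [Fintype V] (G : GNNLogic.FeaturedGraph d V) (v : V),
          ψ.Sat G v ↔ φ.Sat G v) ∧
      -- a simple ACR-GNN captures `φ`
      (∃ N : GNNLogic.ACRGNN d, N.IsSimple ∧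
        ∀ (V : Type) [Fintype V] (G : GNNLogic.FeaturedGraph d V) (v : V),
          N.Accepts G v ↔ φ.Sat G v) := by
  refine ⟨GNNLogic.linearOrderFormula d, fun V _ G v => GNNLogic.sat_linearOrderFormula G v, ?_,
    GNNLogic.linearOrderGNN d, GNNLogic.linearOrderGNN_isSimple d, fun V _ G v => ?_⟩
  · simp only [GNNLogic.sat_linearOrderFormula]
    exact GNNLogic.not_exists_C2Formula_isStrictLinearOrder d
  · rw [GNNLogic.linearOrderGNN_accepts, GNNLogic.sat_linearOrderFormula]
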